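/- For integers $n\ge 1$ and $\mu\ge 0$, the preferential attachment multigraph $G_{pa}(n,\mu)$ is the random multigraph (parallel edges and self loops allowed) built as follows, starting from the empty graph. In round $i=1,\dots,n$ a new vertex $v_i$ is inserted, and then the following step is carried out $\mu$ times, one after the other: an edge is added from $v_i$ to a random vertex $v_j$ with $1\le j\le i$, where $v_j$ is chosen with probability $$\frac{d_{v_j}}{1+\sum_{l=1}^{i}d_{v_l}}\ \text{ if } j<i,\qquad \frac{d_{v_i}+1}{1+\sum_{l=1}^{i}d_{v_l}}\ \text{ if } j=i,$$ and where $d_v$ is the degree of $v$ in the current multigraph, just before the edge is added. Degrees are counted with multiplicity, and a self loop contributes $2$ to the degree of its vertex. Lemma 6.2. There is an absolute constant $c_\mu>0$ such that for all integers $n\ge 1$ and $\mu\ge c_\mu\log n$ the following holds with probability at least $1-\frac1n$ over $G\leftarrow G_{pa}(n,\mu)$, where $d_v$ denotes the degree of $v$ in $G$: every vertex $v$ of $G$ that is not the highest-degree vertex $v_{\max}$ either is a neighbour of $v_{\max}$ or has a neighbour $u$ with $d_u>2\,d_v$. (If several vertices have the highest degree, this holds for each choice of $v_{\max}$ among them.)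 -/

import Mathlib

open scoped ENNReal

namespace PrefAttach

/-- A finite multigraph (parallel edges and self loops allowed), given by its multiset of edges.
The vertices are the natural numbers `0, 1, 2, …`, in the order in which they are inserted. -/
abbrev MGraph : Type := Multiset (Sym2 ℕ)

/-- The degree of `v`: the number of edges at `v`, with multiplicity, each self loop at `v`
being counted twice. -/
def deg (G : MGraph) (v : ℕ) : ℕ :=
  G.countP (fun e => v ∈ e) + G.count s(v, v)

/-- The probability that the next edge sent out by the vertex `i` ends at `j`, when `G` is the
current multigraph (so the degrees are the current ones, including those of the edges that `i`
has already sent out). -/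
noncomputable def targetProb (G : MGraph) (i j : ℕ) : ℝ≥0∞ :=
  if j < i then (deg G j : ℝ≥0∞) / ((∑ l ∈ Finset.range (i + 1), deg G l : ℕ) + 1)
  else if j = i then ((deg G j : ℝ≥0∞) + 1) / ((∑ l ∈ Finset.range (i + 1), deg G l : ℕ) + 1)
  else 0

theorem sum_targetProb (G : MGraph) (i : ℕ) :
    ∑ j ∈ Finset.range (i + 1), targetProb G i j = 1 := by
  have h : ∀ j ∈ Finset.range i, targetProb G i j =
      (deg G j : ℝ≥0∞) / ((∑ l ∈ Finset.range (i + 1), deg G l : ℕ) + 1) := by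
    intro j hj
    simp [targetProb, Finset.mem_range.1 hj]
  rw [Finset.sum_range_succ, Finset.sum_congr rfl h]
  simp only [targetProb, lt_irrefl, if_false, if_true, div_eq_mul_inv]
  rw [← Finset.sum_mul, ← add_mul, ← add_assoc, ← Finset.sum_range_succ, ← Nat.cast_sum]
  exact ENNReal.mul_inv_cancel (by simp) (by finiteness)

theorem targetProb_eq_zero (G : MGraph) (i j : ℕ) (hj : j ∉ Finset.range (i + 1)) :
    targetProb G i j = 0 := by
  simp only [Finset.mem_range, not_lt] at hj
  simp [targetProb, show ¬ j < i by omega, show j ≠ i by omega]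

/-- The law of the other end of the next edge sent out by `i`. -/
noncomputable def target (G : MGraph) (i : ℕ) : PMF ℕ :=
  PMF.ofFinset (targetProb G i) (Finset.range (i + 1)) (sum_targetProb G i)
    (targetProb_eq_zero G i)

/-- Add one random edge from the vertex `i`. -/
noncomputable def addEdge (i : ℕ) (G : MGraph) : PMF MGraph :=
  (target G i).map (fun j => s(i, j) ::ₘ G)

/-- Starting from `G`, add `k` random edges from the vertex `i`, one after the other. -/
noncomputable def addEdges (i : ℕ) (G : MGraph) : ℕ → PMF MGraph
  | 0 => PMF.pure G
  | k + 1 => (addEdges i G k).bind (addEdge i)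

/-- The law of the preferential attachment multigraph with `n` vertices `0, …, n - 1` and
parameter `μ`: starting from the empty graph, the vertices are inserted one after the other,
and each inserted vertex sends out `μ` random edges. -/
noncomputable def prefAttach (μ : ℕ) : ℕ → PMF MGraph
  | 0 => PMF.pure 0
  | n + 1 => (prefAttach μ n).bind (fun G => addEdges n G μ)

/-- `h` is a vertex of highest degree among the vertices `0, …, n - 1`. -/
def IsHighestDegree (n : ℕ) (G : MGraph) (h : ℕ) : Prop :=
  h < n ∧ ∀ v < n, deg G v ≤ deg G h

/-- Every vertex other than the highest-degree vertex is adjacent to the highest-degree vertex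
or has a neighbour of more than twice its degree. In case of a tie for the highest degree,
this is required for each choice of the highest-degree vertex. -/
def HubProperty (n : ℕ) (G : MGraph) : Prop :=
  ∀ h, IsHighestDegree n G h → ∀ v < n, v ≠ h →
    s(v, h) ∈ G ∨ ∃ u < n, s(v, u) ∈ G ∧ 2 * deg G v < deg G u

end PrefAttach

/-! Set `C = 1600`. The property follows deterministically from three families of events: the
vertices below `C` are pairwise adjacent; each `v ≥ C` has a neighbour among the first `v / C`
vertices; and `deg u > 2 * deg v` whenever `C * (u + 1) ≤ v`. The third, with `u = 0`, puts every
highest-degree vertex below `C`, so vertices below `C` are adjacent to it, and the neighbour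
supplied by the second has more than twice the degree of `v` (`hubProperty_of_forall`).

Adjacency: in each family the target set holds a constant fraction of the total degree, so each of
the `μ` edges misses it with probability at most `1 - δ` given the past (`expect_avoid_le`).

Degree comparison: once `i` and `j` have sent their edges, the rising factorial of `deg j` over the
falling factorial of `deg i - 1` has constant expectation. Its expectation when `j` has just been
inserted is small for `j` much larger than `i`, because the reciprocal falling factorial of `deg i -
1` has by then decayed polynomially. Markov's inequality gives `prob_deg_le_two_mul_deg_le`. All
failure probabilities are at most `exp (-μ / 6400)`, and a union bound over at most `n + 2 * n ^ 2`
events finishes. -/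

namespace PMF

/-! ### Expectations under a `PMF`. -/

variable {α β : Type*}

/-- The expectation of an `ℝ≥0∞`-valued function. -/
noncomputable def expect (p : PMF α) (f : α → ℝ≥0∞) : ℝ≥0∞ := ∑' x, p x * f x

theorem expect_pure (a : α) (f : α → ℝ≥0∞) : (PMF.pure a).expect f = f a := by
  unfold expect
  rw [tsum_eq_single a]
  · simp
  · intro b hb
    simp [hb]

theorem expect_bind (p : PMF α) (q : α → PMF β) (f : β → ℝ≥0∞) :
    (p.bind q).expect f = p.expect (fun x => (q x).expect f) := by
  unfold expect
  simp only [bind_apply, ← ENNReal.tsum_mul_right, ← ENNReal.tsum_mul_left]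
  rw [ENNReal.tsum_comm]
  simp only [mul_assoc]

theorem expect_map (p : PMF α) (g : α → β) (f : β → ℝ≥0∞) :
    (p.map g).expect f = p.expect (f ∘ g) := by
  rw [← bind_pure_comp, expect_bind]
  simp [expect_pure, Function.comp_def]

theorem expect_mono {p : PMF α} {f g : α → ℝ≥0∞} (h : ∀ x ∈ p.support, f x ≤ g x) :
    p.expect f ≤ p.expect g := by
  refine ENNReal.tsum_le_tsum fun x => ?_
  by_cases hx : x ∈ p.support
  · gcongr
    exact h x hx
  · simp [(p.apply_eq_zero_iff x).2 hx]

theorem expect_const (p : PMF α) (c : ℝ≥0∞) : p.expect (fun _ => c) = c := by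
  simp [expect, ENNReal.tsum_mul_right, p.tsum_coe]

theorem expect_const_mul (p : PMF α) (c : ℝ≥0∞) (f : α → ℝ≥0∞) :
    p.expect (fun x => c * f x) = c * p.expect f := by
  simp only [expect, ← ENNReal.tsum_mul_left, mul_left_comm]

/-- Markov's inequality, in the only form needed below. -/
theorem toOuterMeasure_le_expect (p : PMF α) (s : Set α) (f : α → ℝ≥0∞)
    (h : ∀ x ∈ p.support, x ∈ s → 1 ≤ f x) : p.toOuterMeasure s ≤ p.expect f := by
  rw [toOuterMeasure_apply]
  refine ENNReal.tsum_le_tsum fun x => ?_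
  by_cases hs : x ∈ s
  · by_cases hx : x ∈ p.support
    · simpa [hs] using mul_le_mul_right (h x hx hs) (p x)
    · simp [(p.apply_eq_zero_iff x).2 hx, hs]
  · simp [hs]

end PMF

namespace PrefAttach

/-! ### Degrees, and what holds surely for graphs in the support. -/

theorem deg_cons (G : MGraph) (a b v : ℕ) :
    deg (s(a, b) ::ₘ G) v = deg G v + (if v = a then 1 else 0) + (if v = b then 1 else 0) := by
  unfold deg
  rw [Multiset.countP_cons, Multiset.count_cons]
  simp only [Sym2.mem_iff, Sym2.eq_iff]
  by_cases h1 : v = a <;> by_cases h2 : v = b <;> simp [h1, h2] <;> grind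

theorem deg_mono {G H : MGraph} (h : G ≤ H) (v : ℕ) : deg G v ≤ deg H v :=
  Nat.add_le_add (Multiset.countP_le_of_le _ h) (Multiset.count_le_of_le _ h)

theorem deg_eq_zero {G : MGraph} {m v : ℕ} (hG : ∀ e ∈ G, ∀ u ∈ e, u < m) (hv : m ≤ v) :
    deg G v = 0 := by
  unfold deg
  rw [Nat.add_eq_zero_iff, Multiset.countP_eq_zero, Multiset.count_eq_zero]
  refine ⟨fun e he hve => ?_, fun he => ?_⟩
  · exact absurd (hG e he v hve) (by omega)
  · exact absurd (hG _ he v (by simp)) (by omega)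

theorem sum_deg (G : MGraph) (m : ℕ) (hG : ∀ e ∈ G, ∀ u ∈ e, u < m) :
    ∑ l ∈ Finset.range m, deg G l = 2 * G.card := by
  induction G using Multiset.induction with
  | empty => simp [deg]
  | cons e G ih =>
    induction e with
    | _ a b =>
    have ha : a < m := hG _ (Multiset.mem_cons_self _ _) a (by simp)
    have hb : b < m := hG _ (Multiset.mem_cons_self _ _) b (by simp)
    simp only [deg_cons, Finset.sum_add_distrib, Finset.sum_ite_eq', Finset.mem_range, ha, hb,
      if_true, Multiset.card_cons, ih fun e he => hG e (Multiset.mem_cons_of_mem he)]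
    ring

theorem support_addEdge {i : ℕ} {G G' : MGraph} (h : G' ∈ (addEdge i G).support) :
    ∃ j ≤ i, G' = s(i, j) ::ₘ G := by
  rw [addEdge, PMF.mem_support_map_iff] at h
  obtain ⟨j, hj, rfl⟩ := h
  refine ⟨j, ?_, rfl⟩
  by_contra hji
  exact (PMF.mem_support_iff _ _).1 hj
    (targetProb_eq_zero G i j (by simp only [Finset.mem_range]; omega))

/-- What is certain about the graph after `k` edges have been sent out by `m`. -/
theorem support_addEdges {m : ℕ} {G : MGraph} (hG : ∀ e ∈ G, ∀ u ∈ e, u < m) (k : ℕ) :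
    ∀ G' ∈ (addEdges m G k).support, G ≤ G' ∧ G'.card = G.card + k ∧
      (∀ e ∈ G', ∀ u ∈ e, u < m + 1) ∧ k ≤ deg G' m ∧ deg G' m ≤ 2 * k := by
  induction k with
  | zero =>
    intro G' h
    simp only [addEdges, PMF.support_pure, Set.mem_singleton_iff] at h
    subst h
    refine ⟨le_rfl, rfl, fun e he u hu => (hG e he u hu).trans (by omega), by omega, ?_⟩
    rw [deg_eq_zero hG le_rfl]
  | succ k ih =>
    intro G'' h
    rw [addEdges, PMF.mem_support_bind_iff] at h
    obtain ⟨G', hG', h⟩ := h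
    obtain ⟨j, hj, rfl⟩ := support_addEdge h
    obtain ⟨h1, h2, h3, h4, h5⟩ := ih G' hG'
    refine ⟨h1.trans (Multiset.le_cons_self _ _), by simp [h2]; ring, ?_, ?_, ?_⟩
    · intro e he u hu
      rcases Multiset.mem_cons.1 he with rfl | he
      · rcases Sym2.mem_iff.1 hu with rfl | rfl <;> omega
      · exact h3 e he u hu
    · rw [deg_cons]; simp; omega
    · rw [deg_cons]; split_ifs <;> omega

theorem support_prefAttach {μ n : ℕ} {G : MGraph} (h : G ∈ (prefAttach μ n).support) :
    (∀ e ∈ G, ∀ u ∈ e, u < n) ∧ G.card = n * μ ∧ ∀ v < n, μ ≤ deg G v := by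
  induction n generalizing G with
  | zero =>
    simp only [prefAttach, PMF.support_pure, Set.mem_singleton_iff] at h
    subst h
    simp
  | succ n ih =>
    rw [prefAttach, PMF.mem_support_bind_iff] at h
    obtain ⟨G', hG', h⟩ := h
    obtain ⟨h1, h2, h3⟩ := ih hG'
    obtain ⟨k1, k2, k3, k4, -⟩ := support_addEdges h1 μ G h
    refine ⟨k3, by rw [k2, h2]; ring, fun v hv => ?_⟩
    rcases Nat.lt_succ_iff_lt_or_eq.1 hv with hv | rfl
    · exact (h3 v hv).trans (deg_mono k1 v)
    · exact k4

theorem exists_le_of_mem_support {μ m n : ℕ} (hmn : m ≤ n) {G : MGraph}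
    (h : G ∈ (prefAttach μ n).support) : ∃ G' ∈ (prefAttach μ m).support, G' ≤ G := by
  induction n, hmn using Nat.le_induction generalizing G with
  | base => exact ⟨G, h, le_rfl⟩
  | succ n hmn ih =>
    rw [prefAttach, PMF.mem_support_bind_iff] at h
    obtain ⟨G₁, hG₁, h⟩ := h
    obtain ⟨G', hG', hle⟩ := ih hG₁
    exact ⟨G', hG', hle.trans (support_addEdges (support_prefAttach hG₁).1 μ G h).1⟩

theorem le_sum_deg_range {μ m n : ℕ} (hmn : m ≤ n) {G : MGraph}
    (h : G ∈ (prefAttach μ n).support) : 2 * (m * μ) ≤ ∑ l ∈ Finset.range m, deg G l := by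
  obtain ⟨G', hG', hle⟩ := exists_le_of_mem_support hmn h
  obtain ⟨h1, h2, -⟩ := support_prefAttach hG'
  rw [← h2, ← sum_deg G' m h1]
  exact Finset.sum_le_sum fun l _ => deg_mono hle l

/-! ### Expectations over one edge, one round and many rounds. -/

/-- The target probabilities as real numbers. -/
noncomputable def targetProbReal (G : MGraph) (i j : ℕ) : ℝ :=
  ((deg G j : ℝ) + if j = i then 1 else 0) / ((∑ l ∈ Finset.range (i + 1), deg G l : ℕ) + 1)

theorem targetProbReal_nonneg (G : MGraph) (i j : ℕ) : 0 ≤ targetProbReal G i j := by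
  unfold targetProbReal
  split_ifs <;> positivity

theorem targetProb_eq_ofReal (G : MGraph) {i j : ℕ} (h : j ≤ i) :
    targetProb G i j = ENNReal.ofReal (targetProbReal G i j) := by
  have hS : ENNReal.ofReal ((∑ l ∈ Finset.range (i + 1), deg G l : ℕ) + 1) =
      (∑ l ∈ Finset.range (i + 1), deg G l : ℕ) + 1 := by
    rw [ENNReal.ofReal_add (Nat.cast_nonneg _) zero_le_one, ENNReal.ofReal_natCast,
      ENNReal.ofReal_one]
  have hd : ENNReal.ofReal ((deg G j : ℝ) + 1) = deg G j + 1 := by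
    rw [ENNReal.ofReal_add (Nat.cast_nonneg _) zero_le_one, ENNReal.ofReal_natCast,
      ENNReal.ofReal_one]
  unfold targetProb targetProbReal
  rw [ENNReal.ofReal_div_of_pos (by positivity), hS]
  rcases h.lt_or_eq with h | rfl
  · simp [h, h.ne]
  · simp [hd]

theorem sum_targetProbReal (G : MGraph) (i : ℕ) :
    ∑ j ∈ Finset.range (i + 1), targetProbReal G i j = 1 := by
  have h := sum_targetProb G i
  rw [Finset.sum_congr rfl fun j hj => targetProb_eq_ofReal G
    (Nat.lt_succ_iff.1 (Finset.mem_range.1 hj)),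
    ← ENNReal.ofReal_sum_of_nonneg fun j _ => targetProbReal_nonneg G i j] at h
  simpa using h

theorem expect_addEdge (i : ℕ) (G : MGraph) (f : MGraph → ℝ) (hf : ∀ G, 0 ≤ f G) :
    (addEdge i G).expect (fun G => ENNReal.ofReal (f G)) =
      ENNReal.ofReal (∑ j ∈ Finset.range (i + 1), targetProbReal G i j * f (s(i, j) ::ₘ G)) := by
  rw [addEdge, PMF.expect_map, PMF.expect, tsum_eq_sum (s := Finset.range (i + 1)),
    ENNReal.ofReal_sum_of_nonneg fun j _ => mul_nonneg (targetProbReal_nonneg G i j) (hf _)]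
  · refine Finset.sum_congr rfl fun j hj => ?_
    rw [ENNReal.ofReal_mul (targetProbReal_nonneg G i j), ← targetProb_eq_ofReal G
      (Nat.lt_succ_iff.1 (Finset.mem_range.1 hj))]
    rfl
  · intro j hj
    rw [show target G i j = 0 from targetProb_eq_zero G i j hj, zero_mul]

/-- With `a` the current value, only targets that change the quantity contribute to the remaining
sum. -/
theorem sum_targetProbReal_mul (G : MGraph) (i : ℕ) (g : ℕ → ℝ) (a : ℝ) :
    ∑ j ∈ Finset.range (i + 1), targetProbReal G i j * g j =
      a + ∑ j ∈ Finset.range (i + 1), targetProbReal G i j * (g j - a) := by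
  simp only [mul_sub, Finset.sum_sub_distrib, ← Finset.sum_mul, sum_targetProbReal]
  ring

theorem expect_addEdges_le {m : ℕ} {G : MGraph} (f : MGraph → ℝ≥0∞) (r : ℝ≥0∞) (μ : ℕ)
    (h : ∀ k < μ, ∀ G' ∈ (addEdges m G k).support, (addEdge m G').expect f ≤ r * f G') :
    (addEdges m G μ).expect f ≤ r ^ μ * f G := by
  induction μ with
  | zero => simp [addEdges, PMF.expect_pure]
  | succ k ih =>
    rw [addEdges, PMF.expect_bind]
    refine (PMF.expect_mono (h k (Nat.lt_succ_self k))).trans ?_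
    rw [PMF.expect_const_mul, pow_succ', mul_assoc]
    gcongr
    exact ih fun l hl => h l (hl.trans (Nat.lt_succ_self k))

theorem expect_prefAttach_succ_le {μ n : ℕ} (f : MGraph → ℝ≥0∞) (g : MGraph → ℝ≥0∞)
    (h : ∀ G ∈ (prefAttach μ n).support, (addEdges n G μ).expect f ≤ g G) :
    (prefAttach μ (n + 1)).expect f ≤ (prefAttach μ n).expect g := by
  rw [prefAttach, PMF.expect_bind]
  exact PMF.expect_mono h

theorem expect_prefAttach_antitone {μ m n : ℕ} (hmn : m ≤ n) (f : MGraph → ℝ≥0∞)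
    (h : ∀ l, m ≤ l → ∀ G ∈ (prefAttach μ l).support, (addEdges l G μ).expect f ≤ f G) :
    (prefAttach μ n).expect f ≤ (prefAttach μ m).expect f := by
  induction n, hmn using Nat.le_induction with
  | base => exact le_rfl
  | succ n hmn ih => exact (expect_prefAttach_succ_le f f (h n hmn)).trans ih

/-- The normalizing constant while `m` sends out its edges. -/
theorem sum_deg_add_one_le {μ m k : ℕ} {G G' : MGraph} (hG : G ∈ (prefAttach μ m).support)
    (hk : k < μ) (hG' : G' ∈ (addEdges m G k).support) :
    ((∑ l ∈ Finset.range (m + 1), deg G' l : ℕ) : ℝ) + 1 ≤ 2 * (m + 1) * μ := by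
  obtain ⟨h1, h2, -⟩ := support_prefAttach hG
  obtain ⟨-, k2, k3, -, -⟩ := support_addEdges h1 k G' hG'
  rw [sum_deg G' (m + 1) k3, k2, h2]
  -- Before the last edge of the round is added, `k ≤ μ - 1`, which leaves room for the `+ 1`.
  have : 2 * (m * μ + k) + 1 ≤ 2 * (m + 1) * μ := by nlinarith
  exact_mod_cast this

/-! ### Failing to hit a set of earlier vertices. -/

open Classical in
/-- The indicator of the event that no edge joins `m` to `S`. -/
noncomputable def avoid (m : ℕ) (S : Finset ℕ) (G : MGraph) : ℝ :=
  if ∃ l ∈ S, s(m, l) ∈ G then 0 else 1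

theorem avoid_nonneg (m : ℕ) (S : Finset ℕ) (G : MGraph) : 0 ≤ avoid m S G := by
  unfold avoid
  split_ifs <;> norm_num

theorem avoid_le_one (m : ℕ) (S : Finset ℕ) (G : MGraph) : avoid m S G ≤ 1 := by
  unfold avoid
  split_ifs <;> norm_num

theorem avoid_anti {m : ℕ} {S : Finset ℕ} {G H : MGraph} (h : G ≤ H) :
    avoid m S H ≤ avoid m S G := by
  by_cases hG : ∃ l ∈ S, s(m, l) ∈ G
  · have hH : ∃ l ∈ S, s(m, l) ∈ H := by
      obtain ⟨l, hl, hlG⟩ := hG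
      exact ⟨l, hl, Multiset.mem_of_le h hlG⟩
    simp [avoid, hG, hH]
  · rw [show avoid m S G = 1 from if_neg hG]
    exact avoid_le_one m S H

theorem avoid_cons (m l : ℕ) (S : Finset ℕ) (G : MGraph) :
    avoid m S (s(m, l) ::ₘ G) = avoid m S G * if l ∈ S then 0 else 1 := by
  have h : (∃ l' ∈ S, s(m, l') ∈ s(m, l) ::ₘ G) ↔ l ∈ S ∨ ∃ l' ∈ S, s(m, l') ∈ G := by
    simp only [Multiset.mem_cons, Sym2.congr_right]
    grind
  unfold avoid
  simp only [h]
  by_cases h1 : l ∈ S <;> by_cases h2 : ∃ l' ∈ S, s(m, l') ∈ G <;> simp [h1, h2]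

theorem expect_addEdge_avoid_le {m : ℕ} {S : Finset ℕ} (hS : S ⊆ Finset.range m) {G : MGraph}
    {δ : ℝ} (hδ : δ ≤ 1)
    (h : δ * ((∑ l ∈ Finset.range (m + 1), deg G l : ℕ) + 1) ≤ ∑ l ∈ S, (deg G l : ℝ)) :
    (addEdge m G).expect (fun G => ENNReal.ofReal (avoid m S G)) ≤
      ENNReal.ofReal (1 - δ) * ENNReal.ofReal (avoid m S G) := by
  rw [expect_addEdge m G _ (avoid_nonneg m S), ← ENNReal.ofReal_mul (by linarith)]
  refine ENNReal.ofReal_le_ofReal ?_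
  have hp : δ ≤ ∑ l ∈ S, targetProbReal G m l := by
    have : ∀ l ∈ S, targetProbReal G m l =
        (deg G l : ℝ) / ((∑ l ∈ Finset.range (m + 1), deg G l : ℕ) + 1) := by
      intro l hl
      have := Finset.mem_range.1 (hS hl)
      simp [targetProbReal, this.ne]
    rw [Finset.sum_congr rfl this, ← Finset.sum_div, le_div_iff₀ (by positivity)]
    exact h
  have hsum : ∑ l ∈ Finset.range (m + 1), targetProbReal G m l * avoid m S (s(m, l) ::ₘ G) =
      avoid m S G - avoid m S G * ∑ l ∈ S, targetProbReal G m l := by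
    have h1 : ∀ l ∈ Finset.range (m + 1),
        targetProbReal G m l * (avoid m S (s(m, l) ::ₘ G) - avoid m S G) =
          if l ∈ S then -(avoid m S G * targetProbReal G m l) else 0 := by
      intro l _
      rw [avoid_cons]
      split_ifs <;> ring
    rw [sum_targetProbReal_mul _ _ _ (avoid m S G), Finset.sum_congr rfl h1,
      Finset.sum_ite_mem, Finset.inter_eq_right.2 (hS.trans (Finset.range_mono m.le_succ)),
      Finset.sum_neg_distrib, Finset.mul_sum]
    ring
  rw [hsum]
  nlinarith [avoid_nonneg m S G]

/-- If the vertices in `S` always have a `δ`-fraction of the total degree, then `m` is unlikely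
to have no neighbour in `S`. -/
theorem expect_avoid_le {μ m n : ℕ} (hmn : m < n) {S : Finset ℕ} (hS : S ⊆ Finset.range m)
    {δ : ℝ} (hδ₀ : 0 ≤ δ) (hδ : δ ≤ 1)
    (h : ∀ G ∈ (prefAttach μ m).support, δ * (2 * (m + 1) * μ) ≤ ∑ l ∈ S, (deg G l : ℝ)) :
    (prefAttach μ n).expect (fun G => ENNReal.ofReal (avoid m S G)) ≤
      ENNReal.ofReal ((1 - δ) ^ μ) := by
  -- Later rounds only add edges, so it suffices to look right after round `m`.
  refine (expect_prefAttach_antitone (m := m + 1) hmn _ fun l _ G hG => ?_).trans ?_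
  · refine (PMF.expect_mono (g := fun _ => ENNReal.ofReal (avoid m S G)) fun G' hG' => ?_).trans
      (PMF.expect_const _ _).le
    exact ENNReal.ofReal_le_ofReal
      (avoid_anti (support_addEdges (support_prefAttach hG).1 μ G' hG').1)
  · refine (expect_prefAttach_succ_le _ (fun _ => ENNReal.ofReal ((1 - δ) ^ μ))
      fun G hG => ?_).trans (PMF.expect_const _ _).le
    refine (expect_addEdges_le _ (ENNReal.ofReal (1 - δ)) μ fun k hk G' hG' => ?_).trans ?_
    · refine expect_addEdge_avoid_le hS hδ ?_
      calc _ ≤ δ * (2 * (m + 1) * μ) := by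
            gcongr
            exact sum_deg_add_one_le hG hk hG'
        _ ≤ ∑ l ∈ S, (deg G l : ℝ) := h G hG
        _ ≤ _ := by
            gcongr with l
            exact deg_mono (support_addEdges (support_prefAttach hG).1 k G' hG').1 l
    · rw [ENNReal.ofReal_pow (by linarith)]
      refine mul_le_of_le_one_right' ?_
      simpa using avoid_le_one m S G

/-! ### Comparing the degrees of an early and a late vertex. -/

/-- The reciprocal of a falling factorial of the degree of `i`. -/
noncomputable def invFalling (i k : ℕ) (G : MGraph) : ℝ := ((deg G i - 1).descFactorial k : ℝ)⁻¹

/-- A quantity that measures how large the degree of `j` is compared with the degree of `i`. -/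
noncomputable def degRatio (i j k : ℕ) (G : MGraph) : ℝ :=
  (deg G j).ascFactorial k * invFalling i k G

theorem invFalling_nonneg (i k : ℕ) (G : MGraph) : 0 ≤ invFalling i k G := by
  unfold invFalling
  positivity

theorem degRatio_nonneg (i j k : ℕ) (G : MGraph) : 0 ≤ degRatio i j k G :=
  mul_nonneg (by positivity) (invFalling_nonneg i k G)

theorem invFalling_anti {i k : ℕ} {G H : MGraph} (h : G ≤ H) (hk : k < deg G i) :
    invFalling i k H ≤ invFalling i k G := by
  unfold invFalling
  have h0 : 0 < (deg G i - 1).descFactorial k := by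
    rw [Nat.pos_iff_ne_zero, Ne, Nat.descFactorial_eq_zero_iff_lt]
    omega
  gcongr
  exact deg_mono h i

/-- With `x` the degree of `i`, a hit has probability proportional to `x` and turns `x - 1` into
`x`. The shift by one makes the expected change an exact multiple of the current value; `k < x`
keeps the denominators nonzero. -/
theorem mul_inv_descFactorial_sub {x k : ℕ} (hk : k < x) :
    (x : ℝ) * ((x.descFactorial k : ℝ)⁻¹ - ((x - 1).descFactorial k : ℝ)⁻¹) =
      -k * ((x - 1).descFactorial k : ℝ)⁻¹ := by
  obtain ⟨y, rfl⟩ : ∃ y, x = y + 1 := ⟨x - 1, by omega⟩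
  have h := Nat.succ_descFactorial y k
  have h1 : (y.descFactorial k : ℝ) ≠ 0 := by
    rw [Nat.cast_ne_zero, Ne, Nat.descFactorial_eq_zero_iff_lt]
    omega
  have h2 : ((y + 1).descFactorial k : ℝ) ≠ 0 := by
    rw [Nat.cast_ne_zero, Ne, Nat.descFactorial_eq_zero_iff_lt]
    omega
  have h3 : ((y : ℝ) + 1 - k) * ((y + 1).descFactorial k : ℝ) = (y + 1) * y.descFactorial k := by
    have := congrArg (Nat.cast (R := ℝ)) h
    rw [Nat.cast_mul, Nat.cast_sub (by omega)] at this
    exact_mod_cast this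
  simp only [Nat.add_sub_cancel, Nat.cast_add, Nat.cast_one]
  field_simp
  linarith

theorem mul_ascFactorial_sub (y k : ℕ) :
    (y : ℝ) * (((y + 1).ascFactorial k : ℝ) - y.ascFactorial k) = k * y.ascFactorial k := by
  have h : (y : ℝ) * (y + 1).ascFactorial k = (y + k) * y.ascFactorial k := by
    exact_mod_cast Nat.succ_ascFactorial y k
  linarith

theorem expect_addEdge_invFalling_le {i k m : ℕ} (him : i < m) {G : MGraph} (hk : k < deg G i)
    {T : ℝ} (hT : (∑ l ∈ Finset.range (m + 1), deg G l : ℕ) + 1 ≤ T) (hkT : k ≤ T) :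
    (addEdge m G).expect (fun G => ENNReal.ofReal (invFalling i k G)) ≤
      ENNReal.ofReal (1 - k / T) * ENNReal.ofReal (invFalling i k G) := by
  have hT₀ : (0 : ℝ) < T := lt_of_lt_of_le (by positivity) hT
  have hkT' : (k : ℝ) / T ≤ 1 := (div_le_one hT₀).2 hkT
  rw [expect_addEdge m G _ (invFalling_nonneg i k), ← ENNReal.ofReal_mul (by linarith)]
  refine ENNReal.ofReal_le_ofReal ?_
  set D : ℝ := (∑ l ∈ Finset.range (m + 1), deg G l : ℕ) + 1 with hD
  have hD₀ : 0 < D := by positivity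
  have h1 : ∀ l ∈ Finset.range (m + 1),
      targetProbReal G m l * (invFalling i k (s(m, l) ::ₘ G) - invFalling i k G) =
        if l = i then -(k / D) * invFalling i k G else 0 := by
    intro l _
    unfold invFalling
    rw [deg_cons, if_neg him.ne]
    split_ifs with h1 h2 h2
    · subst h1
      have := mul_inv_descFactorial_sub hk
      simp only [targetProbReal, ← hD, him.ne, if_false, add_zero, Nat.add_sub_cancel]
      rw [div_mul_eq_mul_div, this]
      ring
    · exact absurd h1.symm h2
    · exact absurd h2.symm h1
    · simp
  rw [sum_targetProbReal_mul _ _ _ (invFalling i k G), Finset.sum_congr rfl h1,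
    Finset.sum_ite_eq', if_pos (Finset.mem_range.2 (by omega))]
  have : (k : ℝ) / T ≤ k / D := by gcongr
  nlinarith [invFalling_nonneg i k G]

/-- An edge from `m` hits at most one of `i` and `j`. The relative drifts `-k / D` and `k / D` of
the two factors cancel, so equality in fact holds. -/
theorem expect_addEdge_degRatio_le {i j k m : ℕ} (hij : i ≠ j) (him : i < m) (hjm : j < m)
    {G : MGraph} (hk : k < deg G i) :
    (addEdge m G).expect (fun G => ENNReal.ofReal (degRatio i j k G)) ≤
      ENNReal.ofReal (degRatio i j k G) := by
  rw [expect_addEdge m G _ (degRatio_nonneg i j k)]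
  refine ENNReal.ofReal_le_ofReal ?_
  set D : ℝ := (∑ l ∈ Finset.range (m + 1), deg G l : ℕ) + 1 with hD
  have h1 : ∀ l ∈ Finset.range (m + 1),
      targetProbReal G m l * (degRatio i j k (s(m, l) ::ₘ G) - degRatio i j k G) =
        (if l = i then -(k / D) * degRatio i j k G else 0) +
          (if l = j then k / D * degRatio i j k G else 0) := by
    intro l _
    unfold degRatio invFalling
    rw [deg_cons, deg_cons, if_neg him.ne, if_neg hjm.ne]
    by_cases hi : l = i
    · subst hi
      have := mul_inv_descFactorial_sub hk
      simp only [targetProbReal, ← hD, him.ne, if_false, if_true, add_zero, Nat.add_sub_cancel,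
        hij, hij.symm]
      rw [← mul_sub, mul_left_comm, div_mul_eq_mul_div, this]
      ring
    · by_cases hj : l = j
      · subst hj
        have := mul_ascFactorial_sub (deg G l) k
        simp only [targetProbReal, ← hD, hjm.ne, if_false, if_true, add_zero, zero_add, hi,
          Ne.symm hi]
        rw [← sub_mul, ← mul_assoc, div_mul_eq_mul_div, this]
        ring
      · simp [hi, hj, Ne.symm hi, Ne.symm hj]
  rw [sum_targetProbReal_mul _ _ _ (degRatio i j k G), Finset.sum_congr rfl h1,
    Finset.sum_add_distrib, Finset.sum_ite_eq', Finset.sum_ite_eq',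
    if_pos (Finset.mem_range.2 (by omega)), if_pos (Finset.mem_range.2 (by omega))]
  apply le_of_eq
  ring

/-- The left side is at most `exp (-q / (m + 1))`, and `exp x ≥ 1 + x` turns this into a factor that
telescopes over rounds. -/
theorem one_sub_div_pow_le (q m μ : ℕ) (hμ : 0 < μ) (hq : 4 * q ≤ μ) :
    (1 - ((2 * q : ℕ) : ℝ) / (2 * (m + 1) * μ)) ^ μ ≤ (((m : ℝ) + 1) / (m + 2)) ^ q := by
  have hμ' : (0 : ℝ) < μ := by exact_mod_cast hμ
  have hm : (0 : ℝ) < m + 1 := by positivity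
  have hq' : (4 * q : ℝ) ≤ μ := by exact_mod_cast hq
  have h0 : ((2 * q : ℕ) : ℝ) / (2 * (m + 1) * μ) ≤ 1 := by
    rw [div_le_one (by positivity)]
    push_cast
    nlinarith
  have hexp : Real.exp (-(1 / ((m : ℝ) + 1))) ≤ ((m : ℝ) + 1) / (m + 2) := by
    rw [Real.exp_neg, inv_le_comm₀ (Real.exp_pos _) (by positivity), inv_div]
    refine le_trans (le_of_eq ?_) (Real.add_one_le_exp _)
    field_simp
    ring
  calc (1 - ((2 * q : ℕ) : ℝ) / (2 * (m + 1) * μ)) ^ μ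
      ≤ Real.exp (-(((2 * q : ℕ) : ℝ) / (2 * (m + 1) * μ))) ^ μ := by
        gcongr
        exact Real.one_sub_le_exp_neg _
    _ = Real.exp (-(1 / ((m : ℝ) + 1))) ^ q := by
        rw [← Real.exp_nat_mul, ← Real.exp_nat_mul]
        congr 1
        push_cast
        field_simp
    _ ≤ _ := by gcongr

/-- Round `i` leaves `i` with degree at least `μ`, giving the last factor; each later round
contributes the decay of `one_sub_div_pow_le`. -/
theorem expect_prefAttach_invFalling_le {q i μ n : ℕ} (hμ : 0 < μ) (hq : 4 * q ≤ μ) (hn : i < n) :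
    (prefAttach μ n).expect (fun G => ENNReal.ofReal (invFalling i (2 * q) G)) ≤
      ENNReal.ofReal ((((i : ℝ) + 2) / (n + 1)) ^ q * (((μ : ℝ) - 2 * q) ^ (2 * q))⁻¹) := by
  have hq' : (4 * q : ℝ) ≤ μ := by exact_mod_cast hq
  have hμ' : (0 : ℝ) < μ := by exact_mod_cast hμ
  have hpos : (0 : ℝ) < μ - 2 * q := by linarith
  induction n, hn using Nat.le_induction with
  | base =>
    refine (PMF.expect_mono fun G hG => ENNReal.ofReal_le_ofReal ?_).trans
      (PMF.expect_const _ _).le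
    have hd := (support_prefAttach hG).2.2 i (Nat.lt_succ_self i)
    have hdesc := Nat.pow_sub_le_descFactorial (deg G i - 1) (2 * q)
    have h1 : (((i : ℝ) + 2) / ((i + 1 : ℕ) + 1)) = 1 := by
      push_cast
      rw [div_eq_one_iff_eq (by positivity)]
      ring
    rw [h1, one_pow, one_mul, invFalling]
    gcongr
    refine le_trans ?_ (Nat.cast_le.2 hdesc)
    push_cast
    gcongr
    have : μ - 2 * q ≤ deg G i - 1 + 1 - 2 * q := by omega
    refine le_trans (le_of_eq ?_) (Nat.cast_le.2 this)
    rw [Nat.cast_sub (by omega)]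
    push_cast
    ring
  | succ n hn ih =>
    refine (expect_prefAttach_succ_le _ (fun G => ENNReal.ofReal ((((n : ℝ) + 1) / (n + 2)) ^ q) *
      ENNReal.ofReal (invFalling i (2 * q) G)) fun G hG => ?_).trans ?_
    · refine (expect_addEdges_le _
        (ENNReal.ofReal (1 - ((2 * q : ℕ) : ℝ) / (2 * (n + 1) * μ))) μ fun k hk G' hG' => ?_).trans ?_
      · have hle := (support_addEdges (support_prefAttach hG).1 k G' hG').1
        have hd := (support_prefAttach hG).2.2 i hn
        have hd' := deg_mono hle i
        refine expect_addEdge_invFalling_le hn (by omega) (sum_deg_add_one_le hG hk hG') ?_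
        push_cast
        have : (0 : ℝ) ≤ n * μ := by positivity
        nlinarith
      · gcongr
        rw [← ENNReal.ofReal_pow]
        · exact ENNReal.ofReal_le_ofReal (one_sub_div_pow_le q n μ hμ hq)
        · rw [sub_nonneg, div_le_one (by positivity)]
          push_cast
          have : (0 : ℝ) ≤ n * μ := by positivity
          nlinarith
    · rw [PMF.expect_const_mul]
      refine (mul_le_mul_right ih _).trans (le_of_eq ?_)
      rw [← ENNReal.ofReal_mul (by positivity), ← mul_assoc, ← mul_pow]
      congr 3
      push_cast
      field_simp
      ring

/-- After round `j` the expectation no longer grows. During round `j` the degree of `j` reaches at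
most `2 * μ`, and the decay of `invFalling` up to then does the rest. The `25` is `5 ^ 2`, from `(2μ
+ 2q) / (μ - 2q) ≤ 5`. -/
theorem expect_prefAttach_degRatio_le {q i j μ n : ℕ} (hμ : 0 < μ) (hq : 4 * q ≤ μ) (hij : i < j)
    (hn : j < n) :
    (prefAttach μ n).expect (fun G => ENNReal.ofReal (degRatio i j (2 * q) G)) ≤
      ENNReal.ofReal ((25 * ((i : ℝ) + 2) / (j + 1)) ^ q) := by
  have hq' : (4 * q : ℝ) ≤ μ := by exact_mod_cast hq
  have hμ' : (0 : ℝ) < μ := by exact_mod_cast hμ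
  have hpos : (0 : ℝ) < μ - 2 * q := by linarith
  refine (expect_prefAttach_antitone (m := j + 1) hn _ fun l hl G hG => ?_).trans ?_
  · refine (expect_addEdges_le _ 1 μ fun k hk G' hG' => ?_).trans (by simp)
    have hd := (support_prefAttach hG).2.2 i (by omega)
    have hd' := deg_mono (support_addEdges (support_prefAttach hG).1 k G' hG').1 i
    rw [one_mul]
    exact expect_addEdge_degRatio_le hij.ne (by omega) (by omega) (by omega)
  · refine (expect_prefAttach_succ_le _ (fun G => ENNReal.ofReal ((2 * μ + 2 * q) ^ (2 * q)) *
      ENNReal.ofReal (invFalling i (2 * q) G)) fun G hG => ?_).trans ?_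
    · refine (PMF.expect_mono fun G' hG' => ?_).trans (PMF.expect_const _ _).le
      obtain ⟨hle, -, -, -, hdeg⟩ := support_addEdges (support_prefAttach hG).1 μ G' hG'
      have hd := (support_prefAttach hG).2.2 i hij
      rw [← ENNReal.ofReal_mul (by positivity)]
      refine ENNReal.ofReal_le_ofReal ?_
      unfold degRatio
      refine mul_le_mul ?_ (invFalling_anti hle (by omega)) (invFalling_nonneg _ _ _)
        (by positivity)
      have h1 : (deg G' j).ascFactorial (2 * q) ≤ (2 * μ + 2 * q) ^ (2 * q) :=
        calc (deg G' j).ascFactorial (2 * q) ≤ (2 * μ + 1).ascFactorial (2 * q) :=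
              Nat.ascFactorial_le _ (by omega)
          _ ≤ _ := Nat.ascFactorial_le_pow_add _ _
      exact_mod_cast h1
    · rw [PMF.expect_const_mul]
      refine (mul_le_mul_right (expect_prefAttach_invFalling_le hμ hq hij) _).trans ?_
      rw [← ENNReal.ofReal_mul (by positivity)]
      refine ENNReal.ofReal_le_ofReal ?_
      have h5 : (2 * (μ : ℝ) + 2 * q) / (μ - 2 * q) ≤ 5 := by
        rw [div_le_iff₀ hpos]
        linarith
      calc _ = ((2 * (μ : ℝ) + 2 * q) / (μ - 2 * q)) ^ (2 * q) * (((i : ℝ) + 2) / (j + 1)) ^ q := by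
            rw [div_pow _ ((μ : ℝ) - 2 * q)]
            ring
        _ ≤ 5 ^ (2 * q) * (((i : ℝ) + 2) / (j + 1)) ^ q := by
            gcongr
        _ = _ := by
            rw [pow_mul, ← mul_pow]
            ring

/-! ### Tail bounds for the bad events. -/

theorem one_le_degRatio {q i j : ℕ} {G : MGraph} (hk : 2 * q < deg G i)
    (h : deg G i ≤ 2 * deg G j) : 1 ≤ (4 : ℝ) ^ q * degRatio i j (2 * q) G := by
  have h0 : 0 < (deg G i - 1).descFactorial (2 * q) := by
    rw [Nat.pos_iff_ne_zero, Ne, Nat.descFactorial_eq_zero_iff_lt]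
    omega
  have h0' : (0 : ℝ) < ((deg G i - 1).descFactorial (2 * q) : ℝ) := by exact_mod_cast h0
  have h1 : (deg G i - 1).descFactorial (2 * q) ≤ 4 ^ q * (deg G j).ascFactorial (2 * q) :=
    calc _ ≤ (deg G i - 1) ^ (2 * q) := Nat.descFactorial_le_pow _ _
      _ ≤ (2 * deg G j) ^ (2 * q) := Nat.pow_le_pow_left (by omega) _
      _ = 4 ^ q * deg G j ^ (2 * q) := by rw [mul_pow, pow_mul 2]; norm_num
      _ ≤ _ := Nat.mul_le_mul_left _ (Nat.pow_succ_le_ascFactorial _ _)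
  rw [degRatio, invFalling, ← mul_assoc, ← div_eq_mul_inv, one_le_div h0']
  exact_mod_cast h1

/-- A vertex is very likely to get more than twice the degree of a much later vertex. -/
theorem prob_deg_le_two_mul_deg_le {i j μ n : ℕ} (hμ : 6 ≤ μ) (hij : 1600 * (i + 1) ≤ j)
    (hn : j < n) :
    (prefAttach μ n).toOuterMeasure {G | deg G i ≤ 2 * deg G j} ≤
      ENNReal.ofReal (Real.exp (-(μ / 6400))) := by
  obtain ⟨q, hq1, hq2⟩ : ∃ q, 4 * q ≤ μ ∧ μ ≤ 8 * q := ⟨μ / 4, by omega, by omega⟩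
  refine (PMF.toOuterMeasure_le_expect _ _ (fun G => ENNReal.ofReal (4 ^ q) *
    ENNReal.ofReal (degRatio i j (2 * q) G)) fun G hG h => ?_).trans ?_
  · have hd := (support_prefAttach hG).2.2 i (by omega)
    rw [← ENNReal.ofReal_mul (by positivity), ENNReal.one_le_ofReal]
    exact one_le_degRatio (by omega) h
  · rw [PMF.expect_const_mul]
    refine (mul_le_mul_right (expect_prefAttach_degRatio_le (by omega) hq1 (by omega) hn) _).trans ?_
    rw [← ENNReal.ofReal_mul (by positivity), ← mul_pow]
    refine ENNReal.ofReal_le_ofReal ?_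
    have hij' : (1600 : ℝ) * (i + 1) ≤ j := by exact_mod_cast hij
    -- As `i + 2 ≤ 2 * (i + 1)`, the left side is at most `200 / 1600 = 1 / 8`.
    have h1 : (4 : ℝ) * (25 * ((i : ℝ) + 2) / (j + 1)) ≤ Real.exp (-1) := by
      have he : (1 / 3 : ℝ) ≤ Real.exp (-1) := by
        rw [Real.exp_neg, one_div]
        gcongr
        exact Real.exp_one_lt_three.le
      refine le_trans ?_ he
      rw [← mul_div_assoc, div_le_div_iff₀ (by positivity) (by norm_num)]
      have : (0 : ℝ) ≤ i := by positivity
      linarith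
    calc _ ≤ Real.exp (-1) ^ q := by gcongr
      _ = Real.exp (-q) := by rw [← Real.exp_nat_mul]; ring_nf
      _ ≤ _ := by
        have : (μ : ℝ) ≤ 8 * q := by exact_mod_cast hq2
        rw [Real.exp_le_exp]
        linarith

theorem prob_no_edge_le {μ m n : ℕ} (hmn : m < n) {S : Finset ℕ} (hS : S ⊆ Finset.range m)
    (h : ∀ G ∈ (prefAttach μ m).support, (m + 1) * μ ≤ 3200 * ∑ l ∈ S, deg G l) :
    (prefAttach μ n).toOuterMeasure {G | ∀ l ∈ S, s(m, l) ∉ G} ≤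
      ENNReal.ofReal (Real.exp (-(μ / 6400))) := by
  refine (PMF.toOuterMeasure_le_expect _ _ (fun G => ENNReal.ofReal (avoid m S G))
    fun G _ hG => ?_).trans ?_
  · have : ¬ ∃ l ∈ S, s(m, l) ∈ G := by
      rintro ⟨l, hl, hlG⟩
      exact hG l hl hlG
    simp [avoid, this]
  · refine (expect_avoid_le hmn hS (δ := 1 / 6400) (by norm_num) (by norm_num)
      fun G hG => ?_).trans (ENNReal.ofReal_le_ofReal ?_)
    · have : ((m : ℝ) + 1) * μ ≤ 3200 * ∑ l ∈ S, (deg G l : ℝ) := by exact_mod_cast h G hG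
      linarith
    · calc _ ≤ Real.exp (-(1 / 6400)) ^ μ := by
            gcongr
            exact (Real.one_sub_le_exp_neg _).trans' (by norm_num)
        _ = _ := by
            rw [← Real.exp_nat_mul]
            ring_nf

/-! ### Deterministic reduction and union bound. -/

/-- The three kinds of bad events imply every failure of the hub property. -/
theorem hubProperty_of_forall {n C : ℕ} (hC : 0 < C) {G : MGraph}
    (h₁ : ∀ v < n, C ≤ v → ∃ l ∈ Finset.range (v / C), s(v, l) ∈ G)
    (h₂ : ∀ v < n, ∀ u < v, v < C → s(v, u) ∈ G)
    (h₃ : ∀ v < n, ∀ u, C * (u + 1) ≤ v → 2 * deg G v < deg G u) : HubProperty n G := by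
  rintro h ⟨hn, hmax⟩ v hv hvh
  have hhC : h < C := by
    by_contra! hCh
    have h1 := h₃ h hn 0 (by omega)
    have h2 := hmax 0 (by omega)
    omega
  rcases lt_or_ge v C with hvC | hvC
  · left
    rcases lt_or_gt_of_ne hvh with hlt | hlt
    · rw [Sym2.eq_swap]
      exact h₂ h hn v hlt hhC
    · exact h₂ v hv h hlt hvC
  · right
    obtain ⟨l, hl, hlG⟩ := h₁ v hv hvC
    have hle : C * (l + 1) ≤ v := by
      rw [mul_comm]
      exact (Nat.le_div_iff_mul_le hC).1 (Finset.mem_range.1 hl)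
    exact ⟨l, by nlinarith, hlG, h₃ v hv l hle⟩

theorem prob_not_hubProperty_le {n μ : ℕ} (hμ : 6 ≤ μ) :
    (prefAttach μ n).toOuterMeasure {G | ¬ HubProperty n G} ≤
      (n + 2 * n * n : ℕ) * ENNReal.ofReal (Real.exp (-(μ / 6400))) := by
  set P := (prefAttach μ n).toOuterMeasure
  set ε := ENNReal.ofReal (Real.exp (-(μ / 6400)))
  let E₁ : ℕ → Set MGraph := fun v =>
    {G | 1600 ≤ v ∧ ∀ l ∈ Finset.range (v / 1600), s(v, l) ∉ G}
  let E₂ : ℕ → ℕ → Set MGraph := fun v u => {G | u < v ∧ v < 1600 ∧ s(v, u) ∉ G}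
  let E₃ : ℕ → ℕ → Set MGraph := fun v u => {G | 1600 * (u + 1) ≤ v ∧ deg G u ≤ 2 * deg G v}
  have hE₁ : ∀ v ∈ Finset.range n, P (E₁ v) ≤ ε := by
    intro v hv
    by_cases hvC : 1600 ≤ v
    · refine (P.mono fun G hG => hG.2).trans (prob_no_edge_le (Finset.mem_range.1 hv)
        (Finset.range_mono (Nat.div_le_self _ _)) fun G hG => ?_)
      have h1 := le_sum_deg_range (Nat.div_le_self v 1600) hG
      -- Uses `v / 1600 ≥ 1`, so rounding down costs at most a factor of two.
      have h2 : v + 1 ≤ 3200 * (2 * (v / 1600)) := by omega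
      nlinarith
    · simp [E₁, hvC]
  have hE₂ : ∀ v ∈ Finset.range n, ∀ u ∈ Finset.range n, P (E₂ v u) ≤ ε := by
    intro v hv u _
    by_cases h : u < v ∧ v < 1600
    · refine (P.mono fun G hG => ?_).trans (prob_no_edge_le (S := {u}) (Finset.mem_range.1 hv)
        (by simpa using h.1) fun G hG => ?_)
      · simpa using hG.2.2
      · have h1 := (support_prefAttach hG).2.2 u h.1
        rw [Finset.sum_singleton]
        exact Nat.mul_le_mul (by omega) h1
    · have : E₂ v u = ∅ := Set.eq_empty_of_forall_notMem fun G hG => h ⟨hG.1, hG.2.1⟩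
      simp [this]
  have hE₃ : ∀ v ∈ Finset.range n, ∀ u ∈ Finset.range n, P (E₃ v u) ≤ ε := by
    intro v hv u _
    by_cases h : 1600 * (u + 1) ≤ v
    · exact (P.mono fun G hG => hG.2).trans
        (prob_deg_le_two_mul_deg_le hμ h (Finset.mem_range.1 hv))
    · simp [E₃, h]
  have hsub : {G | ¬ HubProperty n G} ⊆ ⋃ v ∈ Finset.range n,
      (E₁ v ∪ ⋃ u ∈ Finset.range n, (E₂ v u ∪ E₃ v u)) := by
    intro G hG
    by_contra hnot
    simp only [Set.mem_iUnion, Finset.mem_range, Set.mem_union, not_exists, not_or] at hnot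
    refine hG (hubProperty_of_forall (C := 1600) (by norm_num) (fun v hv hvC => ?_)
      (fun v hv u huv hvC => ?_) fun v hv u huv => ?_)
    · by_contra! hcon
      exact (hnot v hv).1 ⟨hvC, hcon⟩
    · by_contra hcon
      exact ((hnot v hv).2 u (by omega)).1 ⟨huv, hvC, hcon⟩
    · by_contra! hcon
      exact ((hnot v hv).2 u (by omega)).2 ⟨huv, hcon⟩
  calc P {G | ¬ HubProperty n G}
      ≤ ∑ v ∈ Finset.range n, (P (E₁ v) + ∑ u ∈ Finset.range n, (P (E₂ v u) + P (E₃ v u))) := by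
        refine (MeasureTheory.measure_mono hsub).trans ((MeasureTheory.measure_biUnion_finset_le _ _).trans ?_)
        refine Finset.sum_le_sum fun v _ => (MeasureTheory.measure_union_le _ _).trans ?_
        gcongr
        refine (MeasureTheory.measure_biUnion_finset_le _ _).trans ?_
        exact Finset.sum_le_sum fun u _ => MeasureTheory.measure_union_le _ _
    _ ≤ ∑ v ∈ Finset.range n, (ε + ∑ u ∈ Finset.range n, (ε + ε)) := by
        gcongr with v hv u hu
        · exact hE₁ v hv
        · exact hE₂ v hv u hu
        · exact hE₃ v hv u hu
    _ = _ := by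
        simp only [Finset.sum_const, Finset.card_range, nsmul_eq_mul]
        push_cast
        ring

end PrefAttach

/-! ### Choice of the constant. -/

theorem lemma6p2 :
    ∃ c : ℝ, 0 < c ∧ ∀ n μ : ℕ, 1 ≤ n → c * Real.log n ≤ μ →
      1 - 1 / (n : ℝ) ≤ ((PrefAttach.prefAttach μ n).toOuterMeasure
        {G | PrefAttach.HubProperty n G}).toReal := by
  refine ⟨32000, by norm_num, fun n μ hn hμ => ?_⟩
  rcases hn.eq_or_lt with rfl | hn
  · simp
  have hn' : (2 : ℝ) ≤ n := by exact_mod_cast hn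
  have hμ6 : 6 ≤ μ := by
    have h1 : Real.log 2 ≤ Real.log n := Real.log_le_log (by norm_num) hn'
    have h2 := Real.log_two_gt_d9
    have : (6 : ℝ) ≤ μ := by linarith
    exact_mod_cast this
  set P := (PrefAttach.prefAttach μ n).toOuterMeasure
  set H := {G | PrefAttach.HubProperty n G}
  have hbad : P Hᶜ ≤ ENNReal.ofReal (1 / n) := by
    refine (PrefAttach.prob_not_hubProperty_le hμ6).trans ?_
    rw [← ENNReal.ofReal_natCast, ← ENNReal.ofReal_mul (by positivity)]
    refine ENNReal.ofReal_le_ofReal ?_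
    -- `32000 = 5 * 6400`; the fifth power suffices since `n + 2 * n ^ 2 ≤ n ^ 4` for `n ≥ 2`.
    have hexp : Real.exp (-(μ / 6400)) ≤ ((n : ℝ) ^ 5)⁻¹ := by
      rw [Real.exp_neg]
      gcongr
      calc (n : ℝ) ^ 5 = Real.exp ((5 : ℕ) * Real.log n) := by
            rw [Real.exp_nat_mul, Real.exp_log (by positivity)]
        _ ≤ _ := by
            rw [Real.exp_le_exp]
            push_cast
            linarith
    calc _ ≤ ((n + 2 * n * n : ℕ) : ℝ) * ((n : ℝ) ^ 5)⁻¹ := by gcongr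
      _ ≤ 1 / n := by
        rw [← div_eq_mul_inv, div_le_div_iff₀ (by positivity) (by positivity)]
        push_cast
        have h3 : (n : ℝ) ^ 5 = n * n * (n * n) * n := by ring
        have h4 : (4 : ℝ) ≤ n * n := by nlinarith
        have h5 : 4 * ((n : ℝ) * n * n) ≤ n * n * (n * n * n) := by gcongr
        have h6 : (n : ℝ) * n ≤ n * n * n := by nlinarith
        nlinarith
  have htop : P H ≠ ⊤ := by
    refine ne_top_of_le_ne_top ENNReal.one_ne_top ?_
    rw [PMF.toOuterMeasure_apply, ← (PrefAttach.prefAttach μ n).tsum_coe]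
    exact ENNReal.tsum_le_tsum fun G => Set.indicator_le_self _ _ _
  -- Subadditivity of the outer measure suffices, so measurability plays no role.
  have hone : 1 ≤ P H + P Hᶜ := by
    rw [← ((PrefAttach.prefAttach μ n).toOuterMeasure_apply_eq_one_iff Set.univ).2
      (Set.subset_univ _), ← Set.union_compl_self H]
    exact MeasureTheory.measure_union_le _ _
  have h := hone.trans (add_le_add_right hbad _)
  rw [← ENNReal.ofReal_toReal htop, ← ENNReal.ofReal_add ENNReal.toReal_nonneg (by positivity),
    ENNReal.one_le_ofReal] at h
  linarith
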